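/- Let $k\ge 1$ and $n=2k$. Let $\mathrm{Cl}_n$ be the real Clifford algebra of $\mathbb{R}^n$ with $v\cdot v=-\|v\|^2$, let $\mathrm{Spin}(n)\subset \mathrm{Cl}_n$ be the spin group, and let $$\mathrm{Spin}^T(n)=(\mathrm{Spin}(n)\times S^1\times S^1)/\{(1,1,1),(-1,-1,-1)\}.$$ Let $\Delta_{2k}=(\mathbb{C}^2)^{\otimes k}\cong\mathbb{C}^{2^k}$ be the spinor space, on which $\mathrm{Cl}_{2k}$ acts by the spinor representation. In the standard basis of $\mathbb{R}^{2k}$, for $1\le j\le k$, the vector $e_{2j-1}$ acts as $\sigma_3^{\otimes (j-1)}\otimes i\sigma_1\otimes 1^{\otimes(k-j)}$ and $e_{2j}$ acts as $\sigma_3^{\otimes (j-1)}\otimes i\sigma_2\otimes 1^{\otimes(k-j)}$, where $\sigma_1,\sigma_2,\sigma_3$ are the Pauli matrices. Let $\kappa$ be the restriction of this action to $\mathrm{Spin}(2k)$, and let $\kappa^T$ be the representation of $\mathrm{Spin}^T(2k)$ on $\Delta_{2k}$ given by $$\kappa^T[g,z_1,z_2]\psi=z_1^2z_2\,\kappa(g)\psi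 .$$ Let $\Delta_{2k}^{\pm}$ be the $(\pm1)$-eigenspace of the action of $i^k e_1e_2\cdots e_{2k}$ on $\Delta_{2k}$. Then $$\Delta_{2k}=\Delta_{2k}^+\oplus\Delta_{2k}^-,$$ both $\Delta_{2k}^+$ and $\Delta_{2k}^-$ are invariant under $\kappa^T$, and each of them is an irreducible representation of $\mathrm{Spin}^T(2k)$. -/

import Mathlib

noncomputable section

namespace SpinT

/-- The quadratic form `x ↦ -(x₁² + ⋯ + xₙ²)` on `ℝⁿ`. -/
abbrev negSq (n : ℕ) : QuadraticForm ℝ (Fin n → ℝ) :=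
  QuadraticMap.weightedSumSquares ℝ (fun _ : Fin n => (-1 : ℝ))

/-- The real Clifford algebra of Euclidean `ℝⁿ`, in which `v * v = -‖v‖²`. -/
abbrev Cl (n : ℕ) : Type := CliffordAlgebra (negSq n)

/-- The standard generator `eᵢ` of the Clifford algebra. -/
def e {n : ℕ} (i : Fin n) : Cl n := CliffordAlgebra.ι (negSq n) (Pi.single i 1)

/-- The group `Spin(n)` inside the Clifford algebra: even products of unit vectors. -/
abbrev Spin (n : ℕ) : Type := spinGroup (negSq n)

/-- The subgroup `{(1, 1, 1), (-1, -1, -1)}` of `Spin(n) × S¹ × S¹`. -/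
def pmOne (n : ℕ) : Subgroup (Spin n × Circle × Circle) where
  carrier := {x | x = 1 ∨ ((x.1 : Cl n) = -1 ∧ (x.2.1 : ℂ) = -1 ∧ (x.2.2 : ℂ) = -1)}
  one_mem' := Or.inl rfl
  mul_mem' := by
    rintro a b (rfl | ⟨h1, h2, h3⟩) (rfl | ⟨h4, h5, h6⟩)
    · left; simp
    · right; simpa using ⟨h4, h5, h6⟩
    · right; simpa using ⟨h1, h2, h3⟩
    · left
      refine Prod.ext (Subtype.ext ?_) (Prod.ext (Circle.ext ?_) (Circle.ext ?_)) <;>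
        simp [h1, h2, h3, h4, h5, h6]
  inv_mem' := by
    rintro a (rfl | ⟨h1, h2, h3⟩)
    · left; simp
    · right
      refine ⟨?_, ?_, ?_⟩
      · change star (a.1 : Cl n) = -1
        rw [h1]; simp
      · simp [h2]
      · simp [h3]

instance (n : ℕ) : (pmOne n).Normal where
  conj_mem := by
    rintro a (rfl | ⟨h1, h2, h3⟩) g
    · left; simp
    · right
      refine ⟨?_, ?_, ?_⟩
      · change (g.1 : Cl n) * a.1 * ((g.1⁻¹ : Spin n) : Cl n) = -1
        have h : (g.1 : Cl n) * ((g.1⁻¹ : Spin n) : Cl n) = 1 :=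
          congrArg Subtype.val (mul_inv_cancel g.1)
        rw [h1]; simp [h]
      · simp [h2]
      · simp [h3]

/-- `Spin^T(n) = (Spin(n) × S¹ × S¹) / {±1}`. -/
abbrev SpinTGroup (n : ℕ) : Type := (Spin n × Circle × Circle) ⧸ pmOne n

/-- The class `[g, z₁, z₂]`. -/
def cls {n : ℕ} (g : Spin n) (z₁ z₂ : Circle) : SpinTGroup n :=
  QuotientGroup.mk (g, z₁, z₂)

/-- The spinor space `Δ_{2k} = ℂ² ⊗ ⋯ ⊗ ℂ²` (`k` factors), i.e. `ℂ^(2^k)`, written in the product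
basis, which is indexed by `{0, 1}^k`. -/
abbrev Spinor (k : ℕ) : Type := (Fin k → Fin 2) → ℂ

/-- Square matrices acting on `Spinor k`. -/
abbrev SpinorMat (k : ℕ) : Type := Matrix (Fin k → Fin 2) (Fin k → Fin 2) ℂ

/-- The Kronecker product `m₁ ⊗ ⋯ ⊗ m_k` of `2 × 2` matrices. -/
def kron {k : ℕ} (m : Fin k → Matrix (Fin 2) (Fin 2) ℂ) : SpinorMat k :=
  Matrix.of fun a b => ∏ j, m j (a j) (b j)

theorem kron_mul {k : ℕ} (m m' : Fin k → Matrix (Fin 2) (Fin 2) ℂ) :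
    kron m * kron m' = kron (fun j => m j * m' j) := by
  ext a b
  simp only [kron, Matrix.mul_apply, Matrix.of_apply, ← Finset.prod_mul_distrib]
  rw [Finset.prod_univ_sum]
  simp

theorem kron_one {k : ℕ} : kron (fun _ : Fin k => (1 : Matrix (Fin 2) (Fin 2) ℂ)) = 1 := by
  ext a b
  simp only [kron, Matrix.of_apply, Matrix.one_apply]
  by_cases h : a = b
  · simp [h]
  · obtain ⟨j, hj⟩ := Function.ne_iff.mp h
    rw [if_neg h]
    exact Finset.prod_eq_zero (Finset.mem_univ j) (by simp [hj])

theorem kron_neg {k : ℕ} (m m' : Fin k → Matrix (Fin 2) (Fin 2) ℂ) (j₀ : Fin k)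
    (h₀ : m j₀ = -m' j₀) (h : ∀ j, j ≠ j₀ → m j = m' j) : kron m = -kron m' := by
  ext a b
  simp only [kron, Matrix.of_apply, Matrix.neg_apply]
  rw [← Finset.mul_prod_erase _ _ (Finset.mem_univ j₀),
    ← Finset.mul_prod_erase _ (fun j => m' j (a j) (b j)) (Finset.mem_univ j₀), h₀]
  rw [Finset.prod_congr rfl fun j hj => by rw [h j (Finset.ne_of_mem_erase hj)]]
  simp

def pauli1 : Matrix (Fin 2) (Fin 2) ℂ := !![0, 1; 1, 0]

def pauli2 : Matrix (Fin 2) (Fin 2) ℂ := !![0, -Complex.I; Complex.I, 0]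

def pauli3 : Matrix (Fin 2) (Fin 2) ℂ := !![1, 0; 0, -1]

/-- The `j`-th tensor factor of the matrix by which the `i`-th unit vector acts on spinors. -/
def gammaFactor {k : ℕ} (i : Fin (2 * k)) (j : Fin k) : Matrix (Fin 2) (Fin 2) ℂ :=
  if (j : ℕ) < (i : ℕ) / 2 then pauli3
  else if (j : ℕ) = (i : ℕ) / 2 then
    (if (i : ℕ) % 2 = 0 then Complex.I • pauli1 else Complex.I • pauli2)
  else 1

/-- With indices starting at `0`, the unit vector `e_{2j}` acts by
`σ₃ ⊗ ⋯ ⊗ σ₃ ⊗ iσ₁ ⊗ 1 ⊗ ⋯ ⊗ 1` and `e_{2j+1}` by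
`σ₃ ⊗ ⋯ ⊗ σ₃ ⊗ iσ₂ ⊗ 1 ⊗ ⋯ ⊗ 1`, with `j` factors `σ₃` in front. -/
def gamma {k : ℕ} (i : Fin (2 * k)) : SpinorMat k := kron (gammaFactor i)

theorem gamma_sq {k : ℕ} (i : Fin (2 * k)) : gamma i * gamma i = -1 := by
  rw [gamma, kron_mul, ← kron_one]
  refine kron_neg _ _ ⟨(i : ℕ) / 2, by omega⟩ ?_ ?_
  · simp only [gammaFactor, lt_irrefl, if_false, if_true]
    split_ifs <;> ext a b <;> fin_cases a <;> fin_cases b <;> simp [pauli1, pauli2]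
  · intro j hj
    have hj' : (j : ℕ) ≠ (i : ℕ) / 2 := fun h => hj (Fin.ext h)
    simp only [gammaFactor, hj', if_false]
    split_ifs
    · ext a b; fin_cases a <;> fin_cases b <;> simp [pauli3]
    · simp

theorem gamma_anticomm_of_lt {k : ℕ} {i j : Fin (2 * k)} (h : i < j) :
    gamma i * gamma j = -(gamma j * gamma i) := by
  have h' : (i : ℕ) < j := h
  rw [gamma, gamma, kron_mul, kron_mul]
  refine kron_neg _ _ ⟨(i : ℕ) / 2, by omega⟩ ?_ ?_
  · rcases Nat.lt_or_ge ((i : ℕ) / 2) ((j : ℕ) / 2) with hlt | hge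
    · simp only [gammaFactor, lt_irrefl, if_false, if_true, hlt]
      split_ifs <;> ext a b <;> fin_cases a <;> fin_cases b <;>
        simp [pauli1, pauli2, pauli3]
    · have h1 : (i : ℕ) / 2 = (j : ℕ) / 2 := by omega
      have h2 : (i : ℕ) % 2 = 0 := by omega
      have h3 : (j : ℕ) % 2 ≠ 0 := by omega
      simp only [gammaFactor, h1, h2, h3, lt_irrefl, if_false, if_true]
      ext a b
      fin_cases a <;> fin_cases b <;> simp [pauli1, pauli2]
  · intro l hl
    have hl' : (l : ℕ) ≠ (i : ℕ) / 2 := fun h => hl (Fin.ext h)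
    simp only [gammaFactor, hl', if_false]
    rcases Nat.lt_or_ge (l : ℕ) ((i : ℕ) / 2) with hlt | hge
    · have : (l : ℕ) < (j : ℕ) / 2 := by omega
      simp [hlt, this]
    · simp [not_lt.mpr hge]

theorem gamma_anticomm {k : ℕ} {i j : Fin (2 * k)} (h : i ≠ j) :
    gamma i * gamma j = -(gamma j * gamma i) := by
  rcases lt_or_gt_of_ne h with h | h
  · exact gamma_anticomm_of_lt h
  · rw [gamma_anticomm_of_lt h, neg_neg]

/-- Clifford multiplication by vectors, `x ↦ ∑ xᵢ γᵢ`. -/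
def vecMul (k : ℕ) : (Fin (2 * k) → ℝ) →ₗ[ℝ] SpinorMat k :=
  Fintype.linearCombination ℝ (gamma (k := k))

theorem vecMul_sq (k : ℕ) (x : Fin (2 * k) → ℝ) :
    vecMul k x * vecMul k x = algebraMap ℝ (SpinorMat k) (negSq (2 * k) x) := by
  have key : ∀ i j : Fin (2 * k), gamma i * gamma j + gamma j * gamma i =
      if i = j then (-2 : ℝ) • (1 : SpinorMat k) else 0 := by
    intro i j
    split_ifs with h
    · subst h
      rw [gamma_sq]; module
    · rw [gamma_anticomm h]; simp
  have h1 : vecMul k x * vecMul k x = ∑ i, ∑ j, (x i * x j) • (gamma i * gamma j) := by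
    simp only [vecMul, Fintype.linearCombination_apply, Finset.sum_mul_sum, smul_mul_smul_comm]
  have h2 : vecMul k x * vecMul k x = ∑ i, ∑ j, (x i * x j) • (gamma j * gamma i) := by
    rw [h1, Finset.sum_comm]
    refine Finset.sum_congr rfl fun i _ => Finset.sum_congr rfl fun j _ => ?_
    rw [mul_comm (x j)]
  have h3 : (2 : ℝ) • (vecMul k x * vecMul k x) =
      (2 : ℝ) • algebraMap ℝ (SpinorMat k) (negSq (2 * k) x) := by
    rw [two_smul]
    nth_rewrite 1 [h1]
    rw [h2, ← Finset.sum_add_distrib]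
    simp only [← Finset.sum_add_distrib, ← smul_add, key]
    simp only [smul_ite, smul_zero, Finset.sum_ite_eq, Finset.mem_univ, if_true, smul_smul,
      ← Finset.sum_smul, Algebra.algebraMap_eq_smul_one,
      QuadraticMap.weightedSumSquares_apply]
    congr 1
    rw [Finset.mul_sum]
    refine Finset.sum_congr rfl fun i _ => ?_
    simp only [smul_eq_mul]
    ring
  exact smul_right_injective _ (two_ne_zero : (2 : ℝ) ≠ 0) h3

/-- The spinor representation of the Clifford algebra on `Δ_{2k}`: the algebra homomorphism
determined by `eᵢ ↦ γᵢ`. -/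
def cliffordRep (k : ℕ) : Cl (2 * k) →ₐ[ℝ] Module.End ℂ (Spinor k) :=
  ((Matrix.toLinAlgEquiv' (R := ℂ) (n := Fin k → Fin 2)).toAlgHom.restrictScalars ℝ).comp
    (CliffordAlgebra.lift (negSq (2 * k)) ⟨vecMul k, vecMul_sq k⟩)

theorem cliffordRep_e (k : ℕ) (i : Fin (2 * k)) (ψ : Spinor k) :
    cliffordRep k (e i) ψ = (gamma i).mulVec ψ := by
  simp [cliffordRep, e, vecMul]

/-- The spin representation `κ` of `Spin(2k)`: the restriction of the Clifford representation. -/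
def kappa (k : ℕ) : Representation ℂ (Spin (2 * k)) (Spinor k) :=
  (cliffordRep k : Cl (2 * k) →* Module.End ℂ (Spinor k)).comp (spinGroup (negSq (2 * k))).subtype

/-- The representation `(g, z₁, z₂) ↦ z₁² z₂ κ(g)` of `Spin(2k) × S¹ × S¹`. -/
def kappaProd (k : ℕ) : Representation ℂ (Spin (2 * k) × Circle × Circle) (Spinor k) where
  toFun x := ((x.2.1 : ℂ) ^ 2 * (x.2.2 : ℂ)) • kappa k x.1
  map_one' := by simp
  map_mul' x y := by
    simp only [Prod.fst_mul, Prod.snd_mul, Circle.coe_mul, map_mul, smul_mul_smul_comm]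
    congr 1
    ring

/-- The spinor representation `κ^T` of `Spin^T(2k)`. -/
def kappaT (k : ℕ) : Representation ℂ (SpinTGroup (2 * k)) (Spinor k) :=
  QuotientGroup.lift (pmOne (2 * k)) (kappaProd k) (by
    rintro x (rfl | ⟨h1, h2, h3⟩)
    · exact map_one _
    · change ((x.2.1 : ℂ) ^ 2 * (x.2.2 : ℂ)) • cliffordRep k (x.1 : Cl (2 * k)) = 1
      rw [h1, h2, h3]
      simp)

theorem kappaT_cls (k : ℕ) (g : Spin (2 * k)) (z₁ z₂ : Circle) (ψ : Spinor k) :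
    kappaT k (cls g z₁ z₂) ψ = ((z₁ : ℂ) ^ 2 * (z₂ : ℂ)) • kappa k g ψ :=
  rfl

/-- The complex volume element `i^k e₁ e₂ ⋯ e_{2k}`, acting on spinors. -/
def volume (k : ℕ) : Module.End ℂ (Spinor k) :=
  Complex.I ^ k • cliffordRep k (List.ofFn (fun i : Fin (2 * k) => e i)).prod

/-- The positive half-spinors `Δ⁺_{2k}`. -/
def spinorPlus (k : ℕ) : Submodule ℂ (Spinor k) := (volume k).eigenspace 1

/-- The negative half-spinors `Δ⁻_{2k}`. -/
def spinorMinus (k : ℕ) : Submodule ℂ (Spinor k) := (volume k).eigenspace (-1)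

end SpinT

end

/-
On the product basis of `Δ_{2k}`, indexed by `{0, 1}^k = (ℤ/2)^k`, every `γᵢ` acts by a monomial
matrix: the `j`-th pair of generators translates the index by the `j`-th unit vector, up to a
nonzero scalar. Hence `e_{2j} e_{2j+1}` is diagonal with entries `-i (-1)^{c j}`, and the volume
element is diagonal with entries `(-1)^{c 0 + ⋯ + c (k-1)}`. It anticommutes with vectors, hence
commutes with `Spin(2k)`, so its eigenspaces are invariant.

A nonzero subspace invariant under all `eᵢ eⱼ` contains a basis spinor, since the diagonal operators
`e_{2j} e_{2j+1}` separate the indices. It then contains the basis spinors of all indices of the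
same coordinate sum, since the products `e_{2i} e_{2j}` translate by a generating set of the vectors
of coordinate sum `0`. So each eigenspace of the volume element is irreducible already under the
products `eᵢ eⱼ ∈ Spin(2k)`.
-/

namespace SpinT

open CliffordAlgebra

section LinearAlgebra

theorem isCompl_eigenspace_one_neg_one {K V : Type*} [Field K] [NeZero (2 : K)] [AddCommGroup V]
    [Module K V] {f : Module.End K V} (hf : f * f = 1) :
    IsCompl (f.eigenspace 1) (f.eigenspace (-1)) := by
  have hff (x : V) : f (f x) = x := LinearMap.congr_fun hf x
  have hne : (1 : K) ≠ -1 := fun h => two_ne_zero (α := K) (by linear_combination h)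
  refine ⟨f.disjoint_genEigenspace hne 1 1, codisjoint_iff_le_sup.mpr fun x _ => ?_⟩
  refine Submodule.mem_sup.mpr
    ⟨(2⁻¹ : K) • (x + f x), ?_, (2⁻¹ : K) • (x - f x), ?_, ?_⟩
  · rw [Module.End.mem_eigenspace_iff, map_smul, map_add, hff]
    module
  · rw [Module.End.mem_eigenspace_iff, map_smul, map_sub, hff]
    module
  · rw [← smul_add, add_add_sub_cancel, ← two_smul K x, inv_smul_smul₀ two_ne_zero]

theorem prod_ofFn_apply_eq_smul {R M : Type*} [CommSemiring R] [AddCommMonoid M] [Module R M]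
    {n : ℕ} {f : Fin n → Module.End R M} {μ : Fin n → R} {x : M} (h : ∀ j, f j x = μ j • x) :
    (List.ofFn f).prod x = (∏ j, μ j) • x := by
  induction n with
  | zero => simp
  | succ n ih =>
    rw [List.ofFn_succ, List.prod_cons, Module.End.mul_apply, ih fun j => h j.succ, map_smul, h 0,
      smul_smul, mul_comm, ← Fin.prod_univ_succ]

theorem apply_eq_mul_of_apply_single {R ι : Type*} [CommSemiring R] [Finite ι] [DecidableEq ι]
    {f : Module.End R (ι → R)} {d : ι → R} (h : ∀ c, f (Pi.single c 1) = d c • Pi.single c 1)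
    (ψ : ι → R) : f ψ = d * ψ := by
  suffices f = LinearMap.mulLeft R d from LinearMap.congr_fun this ψ
  ext c a
  by_cases hac : a = c <;> simp [h, hac]

end LinearAlgebra

section Representation

variable {A G V : Type*} [CommSemiring A] [Monoid G] [AddCommMonoid V] [Module A V]
  {ρ : Representation A G V}

/-- The subrepresentations of a subrepresentation `σ` of `ρ` are the subrepresentations of `ρ`
contained in `σ`; this identification turns irreducibility of `σ` into being an atom. -/
def subrepresentationOrderIsoIic (σ : Subrepresentation ρ) :
    Subrepresentation σ.toRepresentation ≃o Set.Iic σ where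
  toFun τ :=
    ⟨{ toSubmodule := τ.toSubmodule.map σ.toSubmodule.subtype
       apply_mem_toSubmodule := by
        rintro g _ ⟨x, hx, rfl⟩
        exact ⟨_, τ.apply_mem_toSubmodule g hx, rfl⟩ },
      Submodule.map_subtype_le σ.toSubmodule τ.toSubmodule⟩
  invFun τ :=
    { toSubmodule := τ.1.toSubmodule.comap σ.toSubmodule.subtype
      apply_mem_toSubmodule := fun g _ hx => τ.1.apply_mem_toSubmodule g hx }
  left_inv τ := Subrepresentation.toSubmodule_injective
    (Submodule.comap_map_eq_of_injective σ.toSubmodule.subtype_injective _)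
  right_inv τ := Subtype.ext <| Subrepresentation.toSubmodule_injective <|
    (Submodule.map_comap_subtype _ _).trans (inf_eq_right.mpr τ.2)
  map_rel_iff' := Submodule.map_le_map_iff_of_injective σ.toSubmodule.subtype_injective _ _

end Representation

theorem isIrreducible_toRepresentation_iff {k G V : Type*} [Field k] [Monoid G] [AddCommGroup V]
    [Module k V] {ρ : Representation k G V} {σ : Subrepresentation ρ} :
    σ.toRepresentation.IsIrreducible ↔ IsAtom σ :=
  (subrepresentationOrderIsoIic σ).isSimpleOrder_iff.trans Set.isSimpleOrder_Iic_iff_isAtom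

section Coordinates

variable {K ι : Type*}

/-- The functions by which pointwise multiplication preserves `W`. -/
def multipliers [CommSemiring K] (W : Submodule K (ι → K)) : Subalgebra K (ι → K) where
  carrier := {f | ∀ ψ ∈ W, f * ψ ∈ W}
  mul_mem' hf hg ψ hψ := by
    rw [mul_assoc]
    exact hf _ (hg ψ hψ)
  add_mem' hf hg ψ hψ := by
    rw [add_mul]
    exact W.add_mem (hf ψ hψ) (hg ψ hψ)
  algebraMap_mem' r ψ hψ := by
    rw [← Algebra.smul_def]
    exact W.smul_mem r hψ

theorem single_one_mem_of_separatesPoints [Field K] [Finite ι] [DecidableEq ι]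
    {A : Subalgebra K (ι → K)} (hA : ∀ a b, a ≠ b → ∃ f ∈ A, f a ≠ f b) (a : ι) :
    Pi.single a 1 ∈ A := by
  cases nonempty_fintype ι
  have hpair : ∀ b, ∃ g ∈ A, g a = 1 ∧ (b ≠ a → g b = 0) := by
    intro b
    rcases eq_or_ne a b with rfl | hab
    · exact ⟨1, A.one_mem, rfl, fun h => absurd rfl h⟩
    · obtain ⟨f, hf, hne⟩ := hA a b hab
      refine ⟨(f a - f b)⁻¹ • (f - algebraMap K _ (f b)),
        A.smul_mem (A.sub_mem hf (A.algebraMap_mem _)) _, ?_, fun _ => ?_⟩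
      · simp [inv_mul_cancel₀ (sub_ne_zero.mpr hne)]
      · simp
  choose g hgA hga hgb using hpair
  suffices Pi.single a 1 = ∏ b, g b from this ▸ A.prod_mem fun b _ => hgA b
  ext b
  rw [Finset.prod_apply]
  rcases eq_or_ne b a with rfl | hb
  · simp [hga]
  · rw [Pi.single_eq_of_ne hb]
    exact (Finset.prod_eq_zero (f := fun c => g c b) (Finset.mem_univ b) (hgb b hb)).symm

theorem single_one_mem_of_apply_ne_zero [Field K] [Finite ι] [DecidableEq ι]
    {W : Submodule K (ι → K)} (hW : ∀ a b, a ≠ b → ∃ f ∈ multipliers W, f a ≠ f b)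
    {ψ : ι → K} (hψ : ψ ∈ W) {a : ι} (ha : ψ a ≠ 0) : Pi.single a 1 ∈ W := by
  have hmul : Pi.single a 1 * ψ = ψ a • Pi.single a (1 : K) := by
    ext b
    by_cases hb : b = a <;> simp [hb]
  rw [← W.smul_mem_iff ha, ← hmul]
  exact single_one_mem_of_separatesPoints hW a ψ hψ

/-- The translations of the index set that preserve the set of coordinate vectors lying in `W`. -/
def basisTranslations [Semiring K] [AddMonoid ι] [DecidableEq ι] (W : Submodule K (ι → K)) :
    AddSubmonoid ι where
  carrier := {v | ∀ c, Pi.single c 1 ∈ W → Pi.single (c + v) 1 ∈ W}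
  zero_mem' c hc := by rwa [add_zero]
  add_mem' hv hw c hc := by
    rw [← add_assoc]
    exact hw _ (hv c hc)

theorem mem_of_sum_eq_zero {M : Type*} [AddCommGroup M] [Fintype ι] [DecidableEq ι]
    {S : AddSubmonoid (ι → M)} (hS : ∀ i j x, Pi.single j x - Pi.single i x ∈ S) {v : ι → M}
    (hv : ∑ j, v j = 0) : v ∈ S := by
  rcases isEmpty_or_nonempty ι with _ | ⟨⟨i⟩⟩
  · exact Subsingleton.elim 0 v ▸ S.zero_mem
  · have hsingle : ∑ j, Pi.single i (v j) = (0 : ι → M) := by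
      refine (map_sum (AddMonoidHom.single (fun _ : ι => M) i) v Finset.univ).symm.trans ?_
      rw [hv, map_zero]
    have hsum : v = ∑ j, (Pi.single j (v j) - Pi.single i (v j)) := by
      rw [Finset.sum_sub_distrib, Finset.univ_sum_single, hsingle, sub_zero]
    exact hsum ▸ S.sum_mem fun j _ => hS i j (v j)

end Coordinates

section Clifford

variable {R M : Type*} [CommRing R] [AddCommGroup M] [Module R M] {Q : QuadraticForm R M}

theorem ι_mem_pinGroup {v : M} (hv : Q v = -1) : ι Q v ∈ pinGroup Q := by
  have hsq : ι Q v * ι Q v = -1 := by rw [ι_sq_scalar, hv, map_neg, map_one]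
  have hstar : star (ι Q v) = -ι Q v := star_ι v
  have hleft : -ι Q v * ι Q v = 1 := by rw [neg_mul, hsq, neg_neg]
  have hright : ι Q v * -ι Q v = 1 := by rw [mul_neg, hsq, neg_neg]
  refine pinGroup.mem_iff.mpr ⟨⟨⟨ι Q v, -ι Q v, hright, hleft⟩, ?_, rfl⟩, ?_⟩
  · exact Subgroup.subset_closure ⟨v, rfl⟩
  · exact Unitary.mem_iff.mpr ⟨hstar ▸ hleft, hstar ▸ hright⟩

theorem ι_mul_ι_mem_spinGroup {v w : M} (hv : Q v = -1) (hw : Q w = -1) :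
    ι Q v * ι Q w ∈ spinGroup Q :=
  spinGroup.mem_iff.mpr
    ⟨mul_mem (ι_mem_pinGroup hv) (ι_mem_pinGroup hw), ι_mul_ι_mem_evenOdd_zero Q v w⟩

theorem semiconjBy_map_involute {A : Type*} [Ring A] [Algebra R A] {f : CliffordAlgebra Q →ₐ[R] A}
    {t : A} (ht : ∀ v, SemiconjBy t (f (ι Q v)) (-f (ι Q v))) (x : CliffordAlgebra Q) :
    SemiconjBy t (f x) (f (involute x)) := by
  induction x using CliffordAlgebra.induction with
  | algebraMap r =>
    rw [AlgHom.commutes, AlgHom.commutes, AlgHom.commutes]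
    exact (Algebra.commutes r t).symm
  | ι v =>
    rw [involute_ι, map_neg]
    exact ht v
  | mul x y hx hy =>
    rw [map_mul, map_mul, map_mul]
    exact hx.mul_right hy
  | add x y hx hy =>
    rw [map_add, map_add, map_add]
    exact hx.add_right hy

end Clifford

theorem e_mul_e_mem_spinGroup {n : ℕ} (i j : Fin n) :
    (e i * e j : Cl n) ∈ spinGroup (negSq n) := by
  have hunit (l : Fin n) : negSq n (Pi.single l 1) = -1 := by
    simp [QuadraticMap.weightedSumSquares_apply, Pi.single_apply]
  exact ι_mul_ι_mem_spinGroup (hunit i) (hunit j)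

theorem ι_eq_sum_e {n : ℕ} (v : Fin n → ℝ) : ι (negSq n) v = ∑ i, v i • e i := by
  conv_lhs => rw [pi_eq_sum_univ' v, map_sum]
  simp only [map_smul, e]

section Sign

/-- The character `x ↦ (-1)^x` of `ℤ/2`; its values are the diagonal entries of `σ₃`. -/
def sgn : AddChar (Fin 2) ℂ where
  toFun x := (-1) ^ (x : ℕ)
  map_zero_eq_one' := pow_zero _
  map_add_eq_mul' x y := by fin_cases x <;> fin_cases y <;> simp

theorem sgn_apply (x : Fin 2) : sgn x = (-1) ^ (x : ℕ) := rfl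

theorem sgn_zero : sgn 0 = 1 := sgn.map_zero_eq_one

theorem sgn_one : sgn 1 = -1 := pow_one _

theorem sgn_sum {ι : Type*} (s : Finset ι) (x : ι → Fin 2) :
    sgn (∑ j ∈ s, x j) = ∏ j ∈ s, sgn (x j) :=
  map_prod sgn.toMonoidHom (fun j => Multiplicative.ofAdd (x j)) s

theorem sgn_mul_self (x : Fin 2) : sgn x * sgn x = 1 := by
  rw [sgn_apply, ← mul_pow, neg_one_mul, neg_neg, one_pow]

theorem sgn_injective : Function.Injective sgn := by
  have hne : (1 : ℂ) ≠ -1 := by norm_num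
  intro x y
  fin_cases x <;> fin_cases y <;> simp [sgn_one, hne, hne.symm]

end Sign

variable {k : ℕ}

section Gamma

open Matrix

theorem kron_mulVec_single {m : Fin k → Matrix (Fin 2) (Fin 2) ℂ} {c d : Fin k → Fin 2}
    {r : Fin k → ℂ} (h : ∀ l, m l *ᵥ Pi.single (c l) 1 = r l • Pi.single (d l) 1) :
    kron m *ᵥ Pi.single c 1 = (∏ l, r l) • Pi.single d 1 := by
  have hentry (l : Fin k) (x : Fin 2) : m l x (c l) = r l * (Pi.single (d l) 1 : Fin 2 → ℂ) x := by
    simpa using congrFun (h l) x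
  ext a
  simp only [mulVec_single_one, col_apply, kron, of_apply, hentry, Finset.prod_mul_distrib,
    Pi.smul_apply, smul_eq_mul]
  congr 1
  simp only [Pi.single_apply, funext_iff, Finset.prod_ite_zero, Finset.prod_const_one,
    Finset.mem_univ, true_implies]

/-- The tensor factor of `Δ_{2k}` on which `γᵢ` acts by `iσ₁` or `iσ₂`. -/
def site (i : Fin (2 * k)) : Fin k := ⟨i / 2, by omega⟩

/-- The index of the first generator acting at the tensor factor `j`. -/
def evenIdx (j : Fin k) : Fin (2 * k) := ⟨2 * j, by omega⟩

/-- The index of the second generator acting at the tensor factor `j`. -/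
def oddIdx (j : Fin k) : Fin (2 * k) := ⟨2 * j + 1, by omega⟩

theorem site_evenIdx (j : Fin k) : site (evenIdx j) = j := by
  ext
  simp [site, evenIdx]

theorem site_oddIdx (j : Fin k) : site (oddIdx j) = j :=
  Fin.ext (by simp only [site, oddIdx]; omega)

/-- The nonzero entry in column `x` of the `l`-th tensor factor of `γᵢ`. -/
def gammaFactorCoeff (i : Fin (2 * k)) (l : Fin k) (x : Fin 2) : ℂ :=
  if l < site i then sgn x
  else if l = site i then (if (i : ℕ) % 2 = 0 then Complex.I else -sgn x)
  else 1

/-- The nonzero entry in column `c` of the monomial matrix `γᵢ`. -/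
def gammaCoeff (i : Fin (2 * k)) (c : Fin k → Fin 2) : ℂ := ∏ l, gammaFactorCoeff i l (c l)

theorem gammaCoeff_ne_zero (i : Fin (2 * k)) (c : Fin k → Fin 2) : gammaCoeff i c ≠ 0 := by
  have hsgn (x : Fin 2) : sgn x ≠ 0 := left_ne_zero_of_mul_eq_one (sgn_mul_self x)
  refine Finset.prod_ne_zero_iff.mpr fun l _ => ?_
  unfold gammaFactorCoeff
  split_ifs <;> simp [hsgn]

theorem pauli1_mulVec_single (x : Fin 2) : pauli1 *ᵥ Pi.single x 1 = Pi.single (x + 1) 1 := by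
  ext y
  fin_cases x <;> fin_cases y <;> simp [pauli1]

theorem pauli2_mulVec_single (x : Fin 2) :
    pauli2 *ᵥ Pi.single x 1 = (Complex.I * sgn x) • Pi.single (x + 1) 1 := by
  ext y
  fin_cases x <;> fin_cases y <;> simp [pauli2, sgn_one]

theorem pauli3_mulVec_single (x : Fin 2) : pauli3 *ᵥ Pi.single x 1 = sgn x • Pi.single x 1 := by
  ext y
  fin_cases x <;> fin_cases y <;> simp [pauli3, sgn_one]

theorem gammaFactor_mulVec_single (i : Fin (2 * k)) (l : Fin k) (x : Fin 2) :
    gammaFactor i l *ᵥ Pi.single x 1 = gammaFactorCoeff i l x •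
      Pi.single (x + (Pi.single (site i) 1 : Fin k → Fin 2) l) 1 := by
  rcases lt_trichotomy l (site i) with hl | rfl | hl
  · have hfactor : gammaFactor i l = pauli3 := if_pos hl
    rw [hfactor, pauli3_mulVec_single, gammaFactorCoeff, if_pos hl, Pi.single_eq_of_ne hl.ne,
      add_zero]
  · have hfactor : gammaFactor i (site i) =
        if (i : ℕ) % 2 = 0 then Complex.I • pauli1 else Complex.I • pauli2 :=
      (if_neg (lt_irrefl _)).trans (if_pos rfl)
    rw [hfactor, gammaFactorCoeff, if_neg (lt_irrefl _), if_pos rfl, Pi.single_eq_same]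
    split_ifs
    · rw [smul_mulVec, pauli1_mulVec_single]
    · rw [smul_mulVec, pauli2_mulVec_single, smul_smul, ← mul_assoc, Complex.I_mul_I, neg_one_mul]
  · have hfactor : gammaFactor i l = 1 :=
      (if_neg (not_lt_of_gt hl)).trans (if_neg (Fin.val_ne_of_ne hl.ne'))
    rw [hfactor, one_mulVec, gammaFactorCoeff, if_neg hl.not_gt, if_neg hl.ne', one_smul,
      Pi.single_eq_of_ne hl.ne', add_zero]

theorem gamma_mulVec_single (i : Fin (2 * k)) (c : Fin k → Fin 2) :
    gamma i *ᵥ Pi.single c 1 = gammaCoeff i c • Pi.single (c + Pi.single (site i) 1) 1 :=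
  kron_mulVec_single fun l => gammaFactor_mulVec_single i l (c l)

theorem gammaCoeff_evenIdx_mul_gammaCoeff_oddIdx (j : Fin k) (c : Fin k → Fin 2) :
    gammaCoeff (evenIdx j) (c + Pi.single j 1) * gammaCoeff (oddIdx j) c =
      -(Complex.I * sgn (c j)) := by
  have heven : (evenIdx j : ℕ) % 2 = 0 := Nat.mul_mod_right 2 j
  have hodd : (oddIdx j : ℕ) % 2 = 1 := Nat.mul_add_mod 2 j 1
  rw [gammaCoeff, gammaCoeff, ← Finset.prod_mul_distrib, Finset.prod_eq_single j]
  · simp [gammaFactorCoeff, site_evenIdx, site_oddIdx, heven, hodd]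
  · intro l _ hl
    by_cases hlt : l < j <;>
      simp [gammaFactorCoeff, site_evenIdx, site_oddIdx, hl, hlt, sgn_mul_self]
  · simp

end Gamma

theorem cliffordRep_e_single (i : Fin (2 * k)) (c : Fin k → Fin 2) :
    cliffordRep k (e i) (Pi.single c 1) =
      gammaCoeff i c • Pi.single (c + Pi.single (site i) 1) 1 := by
  rw [cliffordRep_e, gamma_mulVec_single]

theorem cliffordRep_e_mul_e_single (i j : Fin (2 * k)) (c : Fin k → Fin 2) :
    cliffordRep k (e i * e j) (Pi.single c 1) =
      (gammaCoeff i (c + Pi.single (site j) 1) * gammaCoeff j c) •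
        Pi.single (c + (Pi.single (site j) 1 + Pi.single (site i) 1)) 1 := by
  rw [map_mul, Module.End.mul_apply, cliffordRep_e_single, map_smul, cliffordRep_e_single,
    smul_smul, mul_comm, add_assoc]

theorem cliffordRep_evenIdx_mul_oddIdx_single (j : Fin k) (c : Fin k → Fin 2) :
    cliffordRep k (e (evenIdx j) * e (oddIdx j)) (Pi.single c 1) =
      -(Complex.I * sgn (c j)) • Pi.single c 1 := by
  have hshift : (Pi.single j 1 + Pi.single j 1 : Fin k → Fin 2) = 0 := by
    rw [← Pi.single_add]
    exact Pi.single_zero j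
  rw [cliffordRep_e_mul_e_single, site_evenIdx, site_oddIdx, hshift, add_zero,
    gammaCoeff_evenIdx_mul_gammaCoeff_oddIdx]

section Volume

theorem prod_e_eq_prod_pairs (k : ℕ) :
    (List.ofFn fun i : Fin (2 * k) => (e i : Cl (2 * k))).prod =
      (List.ofFn fun j : Fin k => (e (evenIdx j) * e (oddIdx j) : Cl (2 * k))).prod := by
  rw [List.ofFn_mul', List.prod_flatten, List.map_ofFn]
  congr 2
  funext j
  simp [evenIdx, oddIdx, List.ofFn_succ]

theorem volume_single (c : Fin k → Fin 2) :
    volume k (Pi.single c 1) = sgn (∑ j, c j) • Pi.single c 1 := by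
  have hscalar : Complex.I ^ k * ∏ j, -(Complex.I * sgn (c j)) = sgn (∑ j, c j) := by
    have hI (z : ℂ) : Complex.I * -(Complex.I * z) = z := by
      linear_combination -z * Complex.I_mul_I
    rw [sgn_sum, ← Fin.prod_const, ← Finset.prod_mul_distrib]
    exact Finset.prod_congr rfl fun j _ => hI _
  rw [volume, prod_e_eq_prod_pairs, map_list_prod, List.map_ofFn, LinearMap.smul_apply,
    Function.comp_def, prod_ofFn_apply_eq_smul fun j => cliffordRep_evenIdx_mul_oddIdx_single j c,
    smul_smul, hscalar]

theorem volume_apply (ψ : Spinor k) (c : Fin k → Fin 2) :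
    volume k ψ c = sgn (∑ j, c j) * ψ c :=
  congrFun (apply_eq_mul_of_apply_single volume_single ψ) c

theorem volume_mul_self (k : ℕ) : volume k * volume k = 1 := by
  refine LinearMap.ext fun ψ => funext fun c => ?_
  rw [Module.End.mul_apply, volume_apply, volume_apply, ← mul_assoc, sgn_mul_self, one_mul,
    Module.End.one_apply]

theorem mem_eigenspace_volume {p : Fin 2} {ψ : Spinor k} :
    ψ ∈ (volume k).eigenspace (sgn p) ↔ ∀ c, ψ c ≠ 0 → ∑ j, c j = p := by
  simp only [Module.End.mem_eigenspace_iff, funext_iff, volume_apply, Pi.smul_apply, smul_eq_mul,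
    mul_eq_mul_right_iff, sgn_injective.eq_iff, or_iff_not_imp_right, ne_eq]

theorem semiconjBy_volume_e (i : Fin (2 * k)) :
    SemiconjBy (volume k) (cliffordRep k (e i)) (-cliffordRep k (e i)) := by
  refine LinearMap.pi_ext' fun c => LinearMap.ext_ring ?_
  have hsgn : sgn (∑ j, (c + Pi.single (site i) 1 : Fin k → Fin 2) j) = -sgn (∑ j, c j) := by
    simp [Finset.sum_add_distrib, AddChar.map_add_eq_mul, sgn_one]
  change volume k (cliffordRep k (e i) (Pi.single c 1)) =
    -cliffordRep k (e i) (volume k (Pi.single c 1))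
  rw [cliffordRep_e_single, map_smul, volume_single, volume_single, map_smul, cliffordRep_e_single,
    hsgn, neg_smul, smul_neg, smul_comm]

theorem commute_volume_kappa (g : Spin (2 * k)) : Commute (volume k) (kappa k g) := by
  have h := semiconjBy_map_involute (f := cliffordRep k) (t := volume k) (fun v => ?_) g
  · rwa [spinGroup.involute_eq g.2] at h
  · simp only [ι_eq_sum_e, map_sum, map_smul, SemiconjBy, Finset.mul_sum, Finset.sum_mul,
      ← Finset.sum_neg_distrib]
    exact Finset.sum_congr rfl fun i _ =>
      ((semiconjBy_volume_e i).smul_right (v i)).eq.trans (by rw [smul_neg])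

theorem commute_volume_kappaT (x : SpinTGroup (2 * k)) : Commute (volume k) (kappaT k x) := by
  obtain ⟨⟨g, z₁, z₂⟩, rfl⟩ := QuotientGroup.mk_surjective x
  exact (commute_volume_kappa g).smul_right ((z₁ : ℂ) ^ 2 * (z₂ : ℂ))

/-- The half-spinors of parity `p`, with `p = 0` for `Δ⁺` and `p = 1` for `Δ⁻`, as a
subrepresentation of `κ^T`. -/
noncomputable def halfSpinor (k : ℕ) (p : Fin 2) : Subrepresentation (kappaT k) where
  toSubmodule := (volume k).eigenspace (sgn p)
  apply_mem_toSubmodule x :=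
    Module.End.mapsTo_genEigenspace_of_comm (commute_volume_kappaT x) (sgn p) 1

end Volume

section Irreducibility

variable {W : Submodule ℂ (Spinor k)}
  (hW : ∀ i j : Fin (2 * k), ∀ ψ ∈ W, cliffordRep k (e i * e j) ψ ∈ W)

include hW

theorem sgn_mem_multipliers (j : Fin k) : (fun c => sgn (c j)) ∈ multipliers W := by
  intro ψ hψ
  have hdiag := apply_eq_mul_of_apply_single (cliffordRep_evenIdx_mul_oddIdx_single j) ψ
  have hmul : (fun c : Fin k → Fin 2 => sgn (c j)) * ψ =
      Complex.I • cliffordRep k (e (evenIdx j) * e (oddIdx j)) ψ := by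
    rw [hdiag]
    ext c
    simp only [Pi.mul_apply, Pi.smul_apply, smul_eq_mul]
    linear_combination (sgn (c j) * ψ c) * Complex.I_mul_I
  rw [hmul]
  exact W.smul_mem _ (hW _ _ ψ hψ)

theorem single_mem_of_mem {ψ : Spinor k} (hψ : ψ ∈ W) {c : Fin k → Fin 2} (hc : ψ c ≠ 0) :
    (Pi.single c 1 : Spinor k) ∈ W := by
  refine single_one_mem_of_apply_ne_zero (fun a b hab => ?_) hψ hc
  obtain ⟨j, hj⟩ := Function.ne_iff.mp hab
  exact ⟨_, sgn_mem_multipliers hW j, sgn_injective.ne hj⟩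

theorem mem_basisTranslations {v : Fin k → Fin 2} (hv : ∑ j, v j = 0) :
    v ∈ basisTranslations W := by
  have hpair (i j : Fin k) : Pi.single j 1 + Pi.single i 1 ∈ basisTranslations W := by
    intro c hc
    have h := hW (evenIdx i) (evenIdx j) _ hc
    rw [cliffordRep_e_mul_e_single, site_evenIdx, site_evenIdx] at h
    exact (W.smul_mem_iff (mul_ne_zero (gammaCoeff_ne_zero _ _) (gammaCoeff_ne_zero _ _))).mp h
  refine mem_of_sum_eq_zero (fun i j x => ?_) hv
  fin_cases x
  · simp
  · have hneg : (-1 : Fin 2) = 1 := rfl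
    simpa [sub_eq_add_neg, ← Pi.single_neg, hneg] using hpair i j

theorem eigenspace_volume_le {p : Fin 2} (hle : W ≤ (volume k).eigenspace (sgn p)) (hne : W ≠ ⊥) :
    (volume k).eigenspace (sgn p) ≤ W := by
  obtain ⟨ψ, hψ, hψ0⟩ := W.exists_mem_ne_zero_of_ne_bot hne
  obtain ⟨a, ha⟩ := Function.ne_iff.mp hψ0
  have hap : ∑ j, a j = p := mem_eigenspace_volume.mp (hle hψ) a ha
  have hbasis : ∀ b, ∑ j, b j = p → (Pi.single b 1 : Spinor k) ∈ W := by
    intro b hb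
    have hab : ∑ j, (b - a) j = 0 := by simp [hb, hap]
    simpa using mem_basisTranslations hW hab a (single_mem_of_mem hW hψ ha)
  intro φ hφ
  rw [pi_eq_sum_univ' φ]
  refine W.sum_mem fun b _ => ?_
  by_cases hb : φ b = 0
  · simp [hb]
  · exact W.smul_mem _ (hbasis b (mem_eigenspace_volume.mp hφ b hb))

end Irreducibility

theorem halfSpinor_ne_bot (hk : 1 ≤ k) (p : Fin 2) : halfSpinor k p ≠ ⊥ := by
  intro h
  have hsum : ∑ j, (Pi.single ⟨0, hk⟩ p : Fin k → Fin 2) j = p := by simp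
  have hmem : (Pi.single (Pi.single ⟨0, hk⟩ p) 1 : Spinor k) ∈ (volume k).eigenspace (sgn p) := by
    rw [Module.End.mem_eigenspace_iff, volume_single, hsum]
  have hbot : (volume k).eigenspace (sgn p) = ⊥ := congrArg Subrepresentation.toSubmodule h
  rw [hbot, Submodule.mem_bot, Pi.single_eq_zero_iff] at hmem
  exact one_ne_zero hmem

theorem cliffordRep_e_mul_e_mem (τ : Subrepresentation (kappaT k)) (i j : Fin (2 * k))
    {ψ : Spinor k} (hψ : ψ ∈ τ.toSubmodule) : cliffordRep k (e i * e j) ψ ∈ τ.toSubmodule := by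
  have h := τ.apply_mem_toSubmodule (cls ⟨e i * e j, e_mul_e_mem_spinGroup i j⟩ 1 1) hψ
  simpa [kappaT_cls, kappa] using h

theorem isAtom_halfSpinor (hk : 1 ≤ k) (p : Fin 2) : IsAtom (halfSpinor k p) := by
  refine isAtom_iff_le_of_ge.mpr ⟨halfSpinor_ne_bot hk p, fun τ hne hle => ?_⟩
  exact eigenspace_volume_le (fun i j _ => cliffordRep_e_mul_e_mem τ i j) hle
    (fun h => hne (Subrepresentation.toSubmodule_injective h))

end SpinT

theorem mainTheorem5 (k : ℕ) (hk : 1 ≤ k) :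
    IsCompl (SpinT.spinorPlus k) (SpinT.spinorMinus k) ∧
    ∃ Sp Sm : Subrepresentation (SpinT.kappaT k),
      Sp.toSubmodule = SpinT.spinorPlus k ∧
      Sm.toSubmodule = SpinT.spinorMinus k ∧
      Sp.toRepresentation.IsIrreducible ∧
      Sm.toRepresentation.IsIrreducible := by
  refine ⟨SpinT.isCompl_eigenspace_one_neg_one (SpinT.volume_mul_self k),
    SpinT.halfSpinor k 0, SpinT.halfSpinor k 1, ?_, ?_,
    SpinT.isIrreducible_toRepresentation_iff.mpr (SpinT.isAtom_halfSpinor hk 0),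
    SpinT.isIrreducible_toRepresentation_iff.mpr (SpinT.isAtom_halfSpinor hk 1)⟩
  · exact congrArg (SpinT.volume k).eigenspace SpinT.sgn_zero
  · exact congrArg (SpinT.volume k).eigenspace SpinT.sgn_one
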